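/- All logarithms are to base $2$. Let $\mathcal S,\mathcal X,\mathcal N$ be finite sets. A function $f:\mathcal S\times\mathcal X\to\mathcal N$ is a biregular irreducible function (BRI) with regularity set $\mathcal M\subseteq\mathcal N$ and degrees $d_{\mathcal S},d_{\mathcal X}\in\{1,2,\dots\}$ if for every $m\in\mathcal M$: (1) $|\{x:f(s,x)=m\}|=d_{\mathcal S}$ for every $s\in\mathcal S$; (2) $|\{s:f(s,x)=m\}|=d_{\mathcal X}$ for every $x\in\mathcal X$; (3) the symmetric stochastic matrix $P_{f,m}$ on $\mathcal X\times\mathcal X$ with entries $P_{f,m}(x,x')=|\{s:f(s,x)=f(s,x')=m\}|/(d_{\mathcal S}d_{\mathcal X})$ has second-largest eigenvalue modulus $\lambda_2(f,m)<1$. Here, if $\mu_1\ge\dots\ge\mu_{|\mathcal X|}$ are the eigenvalues with multiplicity, the second-largest eigenvalue modulus is $\max(|\mu_2|,|\mu_{|\mathcal X|}|)$ (and $0$ if $|\mathcal X|=1$). Let $G_{f,m}$ be the bipartite graph on the disjoint union of $\mathcal S$ and $\mathcal X$ in which $s\in\mathcal S$ and $x\in\mathcal X$ are adjacent if and only if $f(s,x)=m$,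 and let $\lambda_2(G_{f,m})$ be the second-largest eigenvalue (with multiplicity) of its adjacency matrix. **Lemma.** For every $i$ let $f_i:\mathcal S_i\times\mathcal X_i\to\mathcal N_i$ be a BRI with regularity set $\mathcal M_i$ and degrees $d_{\mathcal S_i},d_{\mathcal X_i}$. Assume that for some $0\le t<1$ the sequence is optimal with parameter $t$, that is, $|\mathcal X_i|\to\infty$, $$\lim_{i\to\infty}\frac{\log|\mathcal M_i|}{\log|\mathcal X_i|}=1-t,\qquad \liminf_{i\to\infty}\frac{\min_{m\in\mathcal M_i}(-\log\lambda_2(f_i,m))}{\log|\mathcal X_i|}\ge t .$$ Then, with upper limits taken in $[-\infty,\infty]$, $$\limsup_{i\to\infty}\frac{\max_{m\in\mathcal M_i}\log\lambda_2(G_{f_i,m})}{\log|\mathcal X_i|}\le\limsup_{i\to\infty}\frac{\log\sqrt{d_{\mathcal X_i}}}{\log|\mathcal X_i|}.$$ If moreover the limits $\lim_{i\to\infty}\log d_{\mathcal S_i}/\log|\mathcal X_i|$ and $\lim_{i\to\infty}\log d_{\mathcal X_i}/\log|\mathcal X_i|$ exist in $[-\infty,\infty]$, then the limits below exist in $[-\infty,\infty]$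 and $$\lim_{i\to\infty}\frac{\max_{m\in\mathcal M_i}\log\lambda_2(G_{f_i,m})}{\log|\mathcal X_i|}=\lim_{i\to\infty}\frac{\log\sqrt{d_{\mathcal X_i}}}{\log|\mathcal X_i|}.$$ -/

import Mathlib

open Filter Topology

noncomputable section

namespace BRI

/-- `sortedEigenvalue A hA k` is the eigenvalue `μ_{k+1}` of the real symmetric matrix `A`, where
`μ_1 ≥ μ_2 ≥ ⋯ ≥ μ_n` are all the eigenvalues of `A`, repeated according to multiplicity
(with the value `0` if `k ≥ n`). -/
def sortedEigenvalue {V : Type*} [Fintype V] [DecidableEq V] (A : Matrix V V ℝ)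
    (hA : A.IsHermitian) (k : ℕ) : ℝ :=
  if h : k < Fintype.card V then hA.eigenvalues₀ ⟨k, h⟩ else 0

/-- The second-largest eigenvalue modulus `max (|μ_2|, |μ_n|)` of a symmetric stochastic matrix
(whose largest eigenvalue `μ_1 = 1` belongs to the all-one vector). A `1 × 1` matrix has no second
eigenvalue, and the value is then `0`. -/
def secondEigenvalueModulus {V : Type*} [Fintype V] [DecidableEq V] (A : Matrix V V ℝ)
    (hA : A.IsHermitian) : ℝ :=
  if 2 ≤ Fintype.card V then
    max |sortedEigenvalue A hA 1| |sortedEigenvalue A hA (Fintype.card V - 1)|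
  else 0

section Functions

variable {S X N : Type*} [Fintype S]

open Classical in
/-- The matrix `P_{f,m}` on `X × X` with entries
`P_{f,m}(x,x') = |{s : f(s,x) = f(s,x') = m}| / (d_S d_X)`. -/
def transitionMatrix (f : S × X → N) (dS dX : ℕ) (m : N) : Matrix X X ℝ :=
  Matrix.of fun x x' =>
    ((Finset.univ.filter fun s : S => f (s, x) = m ∧ f (s, x') = m).card : ℝ) /
      ((dS : ℝ) * (dX : ℝ))

open Classical in
theorem transitionMatrix_isHermitian (f : S × X → N) (dS dX : ℕ) (m : N) :
    (transitionMatrix f dS dX m).IsHermitian := by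
  ext x x'
  simp only [transitionMatrix, Matrix.conjTranspose_apply, Matrix.of_apply, star_trivial]
  congr 2
  exact congrArg Finset.card (Finset.filter_congr fun s _ => and_comm)

variable [Fintype X]

open Classical in
/-- `λ₂(f,m)`: the second-largest eigenvalue modulus of `P_{f,m}`. -/
def lambda2 (f : S × X → N) (dS dX : ℕ) (m : N) : ℝ :=
  secondEigenvalueModulus (transitionMatrix f dS dX m) (transitionMatrix_isHermitian f dS dX m)

open Classical in
/-- `f : S × X → N` is a biregular irreducible function with regularity set `M` and
degrees `d_S`, `d_X`. -/
structure IsBiregularIrreducible (f : S × X → N) (M : Finset N) (dS dX : ℕ) : Prop where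
  dS_pos : 0 < dS
  dX_pos : 0 < dX
  S_regular : ∀ m ∈ M, ∀ s : S, (Finset.univ.filter fun x : X => f (s, x) = m).card = dS
  X_regular : ∀ m ∈ M, ∀ x : X, (Finset.univ.filter fun s : S => f (s, x) = m).card = dX
  irreducible : ∀ m ∈ M, lambda2 f dS dX m < 1

/-- The bipartite graph `G_{f,m}` on the disjoint union of `S` and `X`: `s` and `x` are adjacent
if and only if `f(s,x) = m`. -/
def bipartiteGraph (f : S × X → N) (m : N) : SimpleGraph (S ⊕ X) where
  Adj
    | Sum.inl s, Sum.inr x => f (s, x) = m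
    | Sum.inr x, Sum.inl s => f (s, x) = m
    | _, _ => False
  symm := ⟨by rintro (s | x) (s' | x') h <;> exact h⟩
  loopless := ⟨by rintro (s | x) h <;> exact h⟩

open Classical in
theorem adjMatrix_isHermitian {V : Type*} (G : SimpleGraph V) : (G.adjMatrix ℝ).IsHermitian := by
  ext v w
  simp [SimpleGraph.adjMatrix_apply, G.adj_comm]

open Classical in
/-- `λ₂(G)`: the second-largest eigenvalue (with multiplicity) of the adjacency matrix of `G`. -/
def graphLambda2 {V : Type*} [Fintype V] (G : SimpleGraph V) : ℝ :=
  sortedEigenvalue (G.adjMatrix ℝ) (adjMatrix_isHermitian G) 1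

/-- `min_{m ∈ M} (-log λ₂(f,m))`; the infimum over a nonempty finite set is a minimum. -/
def minNegLogLambda2 (f : S × X → N) (M : Finset N) (dS dX : ℕ) : ℝ :=
  ⨅ m : M, -Real.logb 2 (lambda2 f dS dX m)

/-- `max_{m ∈ M} log λ₂(G_{f,m})`; the supremum over a nonempty finite set is a maximum. -/
def maxLogGraphLambda2 (f : S × X → N) (M : Finset N) : ℝ :=
  ⨆ m : M, Real.logb 2 (graphLambda2 (bipartiteGraph f m))

end Functions

/-- The sequence `(f_i)`, where `f_i` has regularity set `M_i` and degrees `d_{S_i}`, `d_{X_i}`,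
is optimal with parameter `t`: `|X_i| → ∞`, `log |M_i| / log |X_i| → 1 - t`, and
`liminf min_{m ∈ M_i} (-log λ₂(f_i,m)) / log |X_i| ≥ t` (the lower limit being taken in `[-∞,∞]`).
The first two conditions force `|M_i| → ∞`, so that, along biregular irreducible functions,
`M_i` is nonempty and all `λ₂(f_i,m)` with `m ∈ M_i` are positive for all large `i`. -/
structure IsOptimalSequence {S X N : ℕ → Type*} [∀ i, Fintype (S i)] [∀ i, Fintype (X i)]
    (f : ∀ i, S i × X i → N i) (M : ∀ i, Finset (N i)) (dS dX : ℕ → ℕ) (t : ℝ) : Prop where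
  card_tendsto : Tendsto (fun i => Fintype.card (X i)) atTop atTop
  rate : Tendsto (fun i => Real.logb 2 ((M i).card : ℝ) / Real.logb 2 (Fintype.card (X i) : ℝ))
    atTop (𝓝 (1 - t))
  eigenvalue : (t : EReal) ≤ liminf (fun i =>
    ((minNegLogLambda2 (f i) (M i) (dS i) (dX i) / Real.logb 2 (Fintype.card (X i) : ℝ) : ℝ)
      : EReal)) atTop

end BRI

end

namespace BRI

open Matrix

/-! The adjacency matrix of `G_{f,m}` has off-diagonal blocks `W`, `Wᵀ` with `WᵀW = d_S d_X
P_{f,m}`, so positive eigenvalues of the graph are square roots of `d_S d_X` times those of `P`.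
This gives `λ₂(G)² ≤ d_S d_X λ₂(f,m)`. In the other direction `P` has trace `|X|/d_S` and
eigenvalues at most 1, so `μ₂(P) ≥ 1/(2 d_S)` once `2 d_S ≤ |X|`, and `λ₂(G)² ≥ d_X/2`.

Disjointness of fibres gives `|M| d_S ≤ |X|`, which removes `d_S` (`maxLogGraphLambda2_bounds`).
After division by `log |X|`, optimality makes the excess over `log √d_X` at most `(1 - (1-t) - t)/2
= 0` in the limit, so the two normalised sequences differ by a null sequence (`tendsto_sub`). -/

/-! ### Second eigenvalue of a real symmetric matrix. -/

/-- Two orthogonal nonzero eigenvectors with eigenvalues at least `c` force `μ₂ ≥ c`. -/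
theorem le_sortedEigenvalue_one {V : Type*} [Fintype V] [DecidableEq V] {A : Matrix V V ℝ}
    (hA : A.IsHermitian) {v w : V → ℝ} (hv : v ≠ 0) (hw : w ≠ 0) (hvw : v ⬝ᵥ w = 0)
    {a b c : ℝ} (hAv : A *ᵥ v = a • v) (hAw : A *ᵥ w = b • w) (hca : c ≤ a) (hcb : c ≤ b) :
    c ≤ sortedEigenvalue A hA 1 := by
  have hcard : 1 < Fintype.card V := by
    by_contra hle
    have : Subsingleton V := Fintype.card_le_one_iff_subsingleton.mp (not_lt.mp hle)
    obtain ⟨i, hi⟩ := Function.ne_iff.mp hv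
    obtain ⟨j, hj⟩ := Function.ne_iff.mp hw
    obtain rfl := Subsingleton.elim i j
    have hsum : v ⬝ᵥ w = v i * w i := by
      rw [dotProduct, Finset.sum_eq_single i]
      · exact fun k _ hk => (hk (Subsingleton.elim _ _)).elim
      · simp
    exact mul_ne_zero hi hj (hsum ▸ hvw)
  rw [sortedEigenvalue, dif_pos hcard]
  by_contra! hlt
  set e := Fintype.equivOfCardEq (α := Fin (Fintype.card V)) (β := V) (Fintype.card_fin _) with he
  set z : V := e ⟨0, by omega⟩ with hz
  have hsmall : ∀ i, i ≠ z → hA.eigenvalues i < c := by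
    intro i hi
    refine lt_of_le_of_lt (hA.eigenvalues₀_antitone ?_) hlt
    have hne : (e.symm i) ≠ ⟨0, by omega⟩ := by
      intro h0
      exact hi (by rw [hz, ← h0, Equiv.apply_symm_apply])
    rw [Fin.le_def]
    have : (e.symm i).1 ≠ 0 := fun h0 => hne (Fin.ext h0)
    show 1 ≤ (e.symm i).1
    omega
  -- If `μ₂ < c`, only the basis vector at `z` can have eigenvalue at least `c`; `v` and `w` are
  -- then both nonzero multiples of it, so not orthogonal.
  have horth : ∀ (u : V → ℝ) (d : ℝ), A *ᵥ u = d • u → c ≤ d → ∀ i, i ≠ z →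
      u ⬝ᵥ ⇑(hA.eigenvectorBasis i) = 0 := by
    intro u d hu hd i hi
    have h1 : u ⬝ᵥ (A *ᵥ ⇑(hA.eigenvectorBasis i)) = (A *ᵥ u) ⬝ᵥ ⇑(hA.eigenvectorBasis i) := by
      rw [dotProduct_mulVec, ← mulVec_transpose]
      have : Aᵀ = A := by simpa using hA.eq
      rw [this]
    rw [hA.mulVec_eigenvectorBasis, hu, dotProduct_smul, smul_dotProduct, smul_eq_mul,
      smul_eq_mul] at h1
    have h2 := hsmall i hi
    have h3 : (hA.eigenvalues i - d) * (u ⬝ᵥ ⇑(hA.eigenvectorBasis i)) = 0 := by linarith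
    exact (mul_eq_zero.mp h3).resolve_left (by linarith)
  have hparseval : ∀ x y : V → ℝ, ∑ i, (x ⬝ᵥ ⇑(hA.eigenvectorBasis i)) *
      (y ⬝ᵥ ⇑(hA.eigenvectorBasis i)) = x ⬝ᵥ y := by
    intro x y
    have := hA.eigenvectorBasis.sum_inner_mul_inner (WithLp.toLp 2 x) (WithLp.toLp 2 y)
    simpa [EuclideanSpace.inner_eq_star_dotProduct, dotProduct_comm] using this
  have hzero : ∀ (u : V → ℝ), u ≠ 0 → (∀ i, i ≠ z → u ⬝ᵥ ⇑(hA.eigenvectorBasis i) = 0) →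
      u ⬝ᵥ ⇑(hA.eigenvectorBasis z) ≠ 0 := by
    intro u hu h hz0
    apply hu
    rw [← dotProduct_self_eq_zero, ← hparseval u u]
    refine Finset.sum_eq_zero fun i _ => ?_
    by_cases hi : i = z
    · rw [hi, hz0, zero_mul]
    · rw [h i hi, zero_mul]
  have hov := horth v a hAv hca
  have how := horth w b hAw hcb
  have := hparseval v w
  rw [hvw, Finset.sum_eq_single z (fun i _ hi => by rw [hov i hi, zero_mul]) (by simp)] at this
  exact mul_ne_zero (hzero v hv hov) (hzero w hw how) this

/-- Converse to `le_sortedEigenvalue_one`. Together they compare `μ₂` of two matrices by carrying an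
orthogonal pair of eigenvectors from one to the other. -/
theorem exists_orthogonal_eigenvectors {V : Type*} [Fintype V] [DecidableEq V] {A : Matrix V V ℝ}
    (hA : A.IsHermitian) (hcard : 1 < Fintype.card V) :
    ∃ (v w : V → ℝ) (a : ℝ), v ≠ 0 ∧ w ≠ 0 ∧ v ⬝ᵥ w = 0 ∧ A *ᵥ v = a • v ∧
      A *ᵥ w = sortedEigenvalue A hA 1 • w ∧ sortedEigenvalue A hA 1 ≤ a := by
  set e := Fintype.equivOfCardEq (α := Fin (Fintype.card V)) (β := V) (Fintype.card_fin _) with he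
  have hval : ∀ k, hA.eigenvalues (e k) = hA.eigenvalues₀ k := by
    intro k
    show hA.eigenvalues₀ (e.symm (e k)) = _
    rw [Equiv.symm_apply_apply]
  have hne : ∀ i, (⇑(hA.eigenvectorBasis i) : V → ℝ) ≠ 0 := fun i h =>
    hA.eigenvectorBasis.orthonormal.ne_zero i (by ext j; exact congrFun h j)
  rw [sortedEigenvalue, dif_pos hcard]
  refine ⟨hA.eigenvectorBasis (e ⟨0, by omega⟩), hA.eigenvectorBasis (e ⟨1, hcard⟩),
    hA.eigenvalues₀ ⟨0, by omega⟩, hne _, hne _, ?_, ?_, ?_, ?_⟩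
  · have h := hA.eigenvectorBasis.orthonormal.2 (i := e ⟨1, hcard⟩) (j := e ⟨0, by omega⟩)
      (fun h => by simpa using e.injective h)
    beta_reduce at h
    rw [EuclideanSpace.inner_eq_star_dotProduct, star_trivial] at h
    exact h
  · rw [hA.mulVec_eigenvectorBasis, hval]
  · rw [hA.mulVec_eigenvectorBasis, hval]
  · exact hA.eigenvalues₀_antitone (Fin.mk_le_mk.mpr zero_le_one)

/-- Gershgorin: each eigenvalue exceeds some diagonal entry by at most the rest of that row. -/
theorem eigenvalues_le_one_of_stochastic {V : Type*} [Fintype V] [DecidableEq V]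
    {A : Matrix V V ℝ} (hA : A.IsHermitian) (hnonneg : ∀ i j, 0 ≤ A i j)
    (hrow : ∀ i, ∑ j, A i j = 1) (i : V) : hA.eigenvalues i ≤ 1 := by
  have hev : Module.End.HasEigenvalue (Matrix.toLin' A) (hA.eigenvalues i) := by
    refine Module.End.hasEigenvalue_of_hasEigenvector
      (x := (⇑(hA.eigenvectorBasis i) : V → ℝ)) ⟨?_, fun h => ?_⟩
    · rw [Module.End.mem_eigenspace_iff, Matrix.toLin'_apply, hA.mulVec_eigenvectorBasis]
    · exact hA.eigenvectorBasis.orthonormal.ne_zero i (by ext j; exact congrFun h j)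
  obtain ⟨k, hk⟩ := eigenvalue_mem_ball hev
  rw [Metric.mem_closedBall, Real.dist_eq] at hk
  have h1 := (le_abs_self _).trans hk
  simp only [Real.norm_eq_abs, abs_of_nonneg (hnonneg _ _)] at h1
  have h2 := Finset.add_sum_erase Finset.univ (A k) (Finset.mem_univ k)
  rw [hrow] at h2
  linarith

theorem trace_le_of_eigenvalues_le_one {V : Type*} [Fintype V] [DecidableEq V]
    {A : Matrix V V ℝ} (hA : A.IsHermitian) (hcard : 1 < Fintype.card V)
    (hle : ∀ i, hA.eigenvalues i ≤ 1) :
    A.trace ≤ 1 + (Fintype.card V - 1 : ℝ) * sortedEigenvalue A hA 1 := by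
  set e := Fintype.equivOfCardEq (α := Fin (Fintype.card V)) (β := V) (Fintype.card_fin _) with he
  have hbound : ∀ i ∈ Finset.univ.erase (e ⟨0, by omega⟩),
      hA.eigenvalues i ≤ sortedEigenvalue A hA 1 := by
    intro i hi
    rw [sortedEigenvalue, dif_pos hcard]
    refine hA.eigenvalues₀_antitone ?_
    rw [Fin.le_def]
    show 1 ≤ (e.symm i).1
    rw [Nat.one_le_iff_ne_zero]
    intro h0
    refine (Finset.mem_erase.mp hi).1 ?_
    have h1 : e.symm i = ⟨0, by omega⟩ := Fin.ext h0
    rw [← h1, Equiv.apply_symm_apply]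
  have hsum := Finset.sum_le_card_nsmul _ _ _ hbound
  rw [Finset.card_erase_of_mem (Finset.mem_univ _), Finset.card_univ, nsmul_eq_mul,
    Nat.cast_sub (by omega), Nat.cast_one] at hsum
  rw [hA.trace_eq_sum_eigenvalues]
  have h2 := Finset.add_sum_erase Finset.univ hA.eigenvalues (Finset.mem_univ (e ⟨0, by omega⟩))
  have h3 := hle (e ⟨0, by omega⟩)
  simp only [RCLike.ofReal_real_eq_id, id_eq]
  linarith

/-! ### Passing between the spectra of the bipartite matrix and of `P`. -/

section Bipartite

variable {S X : Type*} [Fintype S] [Fintype X] [DecidableEq X]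
  [DecidableEq (S ⊕ X)]

/-- If `WᵀW = c P`, then `μ₂` of the bipartite adjacency matrix of `W` is, when positive, at most
`√(c μ₂(P))`. -/
theorem sq_sortedEigenvalue_fromBlocks_le {W : Matrix S X ℝ} {P : Matrix X X ℝ} {c : ℝ}
    (hc : 0 < c) (hP : P.IsHermitian) (hW : Wᵀ * W = c • P)
    (hA : (fromBlocks 0 W Wᵀ 0).IsHermitian)
    (hpos : 0 < sortedEigenvalue _ hA 1) :
    sortedEigenvalue _ hA 1 ^ 2 ≤ c * sortedEigenvalue P hP 1 := by
  have hcard : 1 < Fintype.card (S ⊕ X) := by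
    by_contra h
    rw [sortedEigenvalue, dif_neg h] at hpos
    exact hpos.false
  obtain ⟨v, w, a, hv, hw, hvw, hAv, hAw, hle⟩ := exists_orthogonal_eigenvectors hA hcard
  set μ := sortedEigenvalue _ hA 1 with hμ
  have hpair : ∀ (u : S ⊕ X → ℝ) (d : ℝ), fromBlocks 0 W Wᵀ 0 *ᵥ u = d • u →
      W *ᵥ (u ∘ Sum.inr) = d • (u ∘ Sum.inl) ∧ Wᵀ *ᵥ (u ∘ Sum.inl) = d • (u ∘ Sum.inr) := by
    intro u d hu
    rw [fromBlocks_mulVec] at hu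
    constructor
    · ext s
      simpa using congrFun hu (Sum.inl s)
    · ext x
      simpa using congrFun hu (Sum.inr x)
  have hne : ∀ (u : S ⊕ X → ℝ) (d : ℝ), fromBlocks 0 W Wᵀ 0 *ᵥ u = d • u → 0 < d → u ≠ 0 →
      u ∘ Sum.inr ≠ 0 := by
    intro u d hu hd hu0 h0
    have h1 := (hpair u d hu).1
    rw [h0, mulVec_zero] at h1
    have h2 := (smul_eq_zero.mp h1.symm).resolve_left hd.ne'
    apply hu0
    ext (s | x)
    · exact congrFun h2 s
    · exact congrFun h0 x
  have hPe : ∀ (u : S ⊕ X → ℝ) (d : ℝ), fromBlocks 0 W Wᵀ 0 *ᵥ u = d • u →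
      P *ᵥ (u ∘ Sum.inr) = (d ^ 2 / c) • (u ∘ Sum.inr) := by
    intro u d hu
    obtain ⟨h1, h2⟩ := hpair u d hu
    have h3 : c • (P *ᵥ (u ∘ Sum.inr)) = d ^ 2 • (u ∘ Sum.inr) := by
      rw [← smul_mulVec, ← hW, ← mulVec_mulVec, h1, mulVec_smul, h2, smul_smul, sq]
    rw [div_eq_inv_mul, mul_smul, ← h3, smul_smul, inv_mul_cancel₀ hc.ne', one_smul]
  have ha : 0 < a := hpos.trans_le hle
  -- The `S`- and `X`-inner products sum to 0, and moving `W` across gives `μ⟨v_S,w_S⟩ =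
  -- a⟨v_X,w_X⟩`; since `a + μ > 0`, both vanish.
  have horth : (v ∘ Sum.inr) ⬝ᵥ (w ∘ Sum.inr) = 0 := by
    have h1 : (v ∘ Sum.inl) ⬝ᵥ (w ∘ Sum.inl) + (v ∘ Sum.inr) ⬝ᵥ (w ∘ Sum.inr) = 0 := by
      simpa [dotProduct, Fintype.sum_sum_type] using hvw
    have h2 : μ * ((v ∘ Sum.inl) ⬝ᵥ (w ∘ Sum.inl)) = a * ((v ∘ Sum.inr) ⬝ᵥ (w ∘ Sum.inr)) := by
      rw [← smul_eq_mul, ← dotProduct_smul, ← (hpair w μ hAw).1, dotProduct_mulVec,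
        ← mulVec_transpose, (hpair v a hAv).2, smul_dotProduct, smul_eq_mul]
    have h3 : (a + μ) * ((v ∘ Sum.inr) ⬝ᵥ (w ∘ Sum.inr)) = 0 := by
      linear_combination μ * h1 - h2
    exact (mul_eq_zero.mp h3).resolve_left (by linarith)
  have := le_sortedEigenvalue_one hP (c := μ ^ 2 / c) (hne v a hAv ha hv) (hne w μ hAw hpos hw)
    horth (hPe v a hAv) (hPe w μ hAw) (by gcongr) le_rfl
  rw [div_le_iff₀ hc] at this
  linarith

/-- An eigenvector `u` of `P` with eigenvalue `d > 0` lifts to `(Wu, √(cd) u)`, with eigenvalue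
`√(cd)`; the lift preserves orthogonality. -/
theorem sqrt_le_sortedEigenvalue_fromBlocks {W : Matrix S X ℝ} {P : Matrix X X ℝ} {c : ℝ}
    (hc : 0 < c) (hP : P.IsHermitian) (hW : Wᵀ * W = c • P)
    (hA : (fromBlocks 0 W Wᵀ 0).IsHermitian) (hpos : 0 < sortedEigenvalue P hP 1) :
    √(c * sortedEigenvalue P hP 1) ≤ sortedEigenvalue _ hA 1 := by
  have hcard : 1 < Fintype.card X := by
    by_contra h
    rw [sortedEigenvalue, dif_neg h] at hpos
    exact hpos.false
  obtain ⟨v, w, a, hv, hw, hvw, hPv, hPw, hle⟩ := exists_orthogonal_eigenvectors hP hcard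
  set μ := sortedEigenvalue P hP 1 with hμ
  have ha : 0 < a := hpos.trans_le hle
  have heig : ∀ (u : X → ℝ) (d : ℝ), 0 < d → P *ᵥ u = d • u →
      fromBlocks 0 W Wᵀ 0 *ᵥ Sum.elim (W *ᵥ u) (√(c * d) • u) =
        √(c * d) • Sum.elim (W *ᵥ u) (√(c * d) • u) := by
    intro u d hd hu
    have hsq : √(c * d) * √(c * d) = c * d := Real.mul_self_sqrt (by positivity)
    rw [fromBlocks_mulVec]
    have h1 : Wᵀ *ᵥ (W *ᵥ u) = (c * d) • u := by
      rw [mulVec_mulVec, hW, smul_mulVec, hu, smul_smul]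
    ext (s | x)
    · simp [mulVec_smul]
    · have := congrFun h1 x
      simp only [Sum.elim_comp_inl, Sum.elim_comp_inr, zero_mulVec, add_zero, Sum.elim_inr,
        Pi.smul_apply, smul_eq_mul] at this ⊢
      rw [this, ← mul_assoc, hsq]
  have hne : ∀ (u : X → ℝ) (d : ℝ), 0 < d → u ≠ 0 →
      Sum.elim (W *ᵥ u) (√(c * d) • u) ≠ 0 := by
    intro u d hd hu h0
    have h1 : √(c * d) • u = 0 := funext fun x => congrFun h0 (Sum.inr x)
    exact hu ((smul_eq_zero.mp h1).resolve_left (Real.sqrt_pos.mpr (by positivity)).ne')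
  refine le_sortedEigenvalue_one hA (hne v a ha hv) (hne w μ hpos hw) ?_ (heig v a ha hPv)
    (heig w μ hpos hPw) (Real.sqrt_le_sqrt (by gcongr)) le_rfl
  have h1 : (W *ᵥ v) ⬝ᵥ (W *ᵥ w) = 0 := by
    rw [dotProduct_comm, dotProduct_mulVec, ← mulVec_transpose, mulVec_mulVec, hW, smul_mulVec, hPw,
      smul_dotProduct, smul_dotProduct, dotProduct_comm, hvw, smul_zero, smul_zero]
  rw [sumElim_dotProduct_sumElim, h1, smul_dotProduct, dotProduct_smul, hvw]
  simp

end Bipartite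

/-! ### Counting in a BRI and two-sided bounds on `λ₂(G_{f,m})`. -/

section Incidence

variable {S X N : Type*}

open Classical in
/-- The biadjacency matrix of `G_{f,m}`. -/
noncomputable def biadjacency (f : S × X → N) (m : N) : Matrix S X ℝ :=
  Matrix.of fun s x => if f (s, x) = m then 1 else 0

open Classical in
theorem adjMatrix_bipartiteGraph (f : S × X → N) (m : N) :
    (bipartiteGraph f m).adjMatrix ℝ =
      fromBlocks 0 (biadjacency f m) (biadjacency f m)ᵀ 0 := by
  ext (s | x) (s' | x') <;> rw [SimpleGraph.adjMatrix_apply]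
  · exact if_neg id
  · rfl
  · rfl
  · exact if_neg id

variable [Fintype S]

open Classical in
theorem transpose_biadjacency_mul_self (f : S × X → N) (m : N) {dS dX : ℕ} (hS : 0 < dS)
    (hX : 0 < dX) :
    (biadjacency f m)ᵀ * biadjacency f m =
      ((dS : ℝ) * (dX : ℝ)) • transitionMatrix f dS dX m := by
  have : (dS : ℝ) * (dX : ℝ) ≠ 0 := by positivity
  ext x x'
  simp only [mul_apply, transpose_apply, biadjacency, of_apply, Matrix.smul_apply, transitionMatrix,
    smul_eq_mul]
  rw [mul_div_cancel₀ _ this]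
  simp only [mul_ite, mul_one, mul_zero, ← ite_and, Finset.sum_boole]
  exact congrArg (fun t : Finset S => (t.card : ℝ)) (Finset.filter_congr fun s _ => and_comm)

variable [Fintype X] {f : S × X → N} {M : Finset N} {dS dX : ℕ}

open Classical in
theorem IsBiregularIrreducible.sum_transitionMatrix (h : IsBiregularIrreducible f M dS dX)
    {m : N} (hm : m ∈ M) (x : X) : ∑ x', transitionMatrix f dS dX m x x' = 1 := by
  have hS := h.dS_pos
  have hX := h.dX_pos
  simp only [transitionMatrix, of_apply]
  rw [← Finset.sum_div, div_eq_one_iff_eq (by positivity)]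
  have hsum : ∑ x', (Finset.univ.filter fun s : S => f (s, x) = m ∧ f (s, x') = m).card =
      dS * dX := by
    simp_rw [← Finset.filter_filter]
    rw [← h.X_regular m hm x, mul_comm]
    simp_rw [Finset.card_filter _ (Finset.filter _ _)]
    rw [Finset.sum_comm]
    simp_rw [← Finset.card_filter, h.S_regular m hm]
    simp
  exact_mod_cast hsum

open Classical in
theorem IsBiregularIrreducible.trace_transitionMatrix (h : IsBiregularIrreducible f M dS dX)
    {m : N} (hm : m ∈ M) :
    (transitionMatrix f dS dX m).trace = (Fintype.card X : ℝ) / dS := by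
  have hS : (dS : ℝ) ≠ 0 := by exact_mod_cast h.dS_pos.ne'
  have hX : (dX : ℝ) ≠ 0 := by exact_mod_cast h.dX_pos.ne'
  simp only [trace, diag_apply, transitionMatrix, of_apply, and_self, h.X_regular m hm,
    Finset.sum_const, Finset.card_univ, nsmul_eq_mul]
  field_simp

open Classical in
-- For one fixed `s`, the fibres of `f(s,·)` over `M` are disjoint and have size `d_S`.
theorem IsBiregularIrreducible.card_mul_le (h : IsBiregularIrreducible f M dS dX)
    [Nonempty S] : M.card * dS ≤ Fintype.card X := by
  obtain ⟨s⟩ := ‹Nonempty S›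
  rw [← smul_eq_mul, ← Finset.sum_const, ← Finset.sum_congr rfl fun m hm => h.S_regular m hm s,
    ← Finset.card_biUnion]
  · exact Finset.card_le_univ _
  · intro m _ m' _ hne
    refine Finset.disjoint_left.mpr fun x hx hx' => hne ?_
    rw [← (Finset.mem_filter.mp hx).2, ← (Finset.mem_filter.mp hx').2]

theorem IsBiregularIrreducible.nonempty_left (h : IsBiregularIrreducible f M dS dX)
    (hM : M.Nonempty) [Nonempty X] : Nonempty S := by
  classical
  obtain ⟨m, hm⟩ := hM
  obtain ⟨x⟩ := ‹Nonempty X›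
  have := h.X_regular m hm x
  have hX := h.dX_pos
  rw [← this] at hX
  obtain ⟨s, -⟩ := Finset.card_pos.mp hX
  exact ⟨s⟩

open Classical in
theorem IsBiregularIrreducible.one_le_mul_sortedEigenvalue (h : IsBiregularIrreducible f M dS dX)
    {m : N} (hm : m ∈ M) (hcard : 1 < Fintype.card X) (hdS : 2 * dS ≤ Fintype.card X) :
    1 ≤ 2 * (dS : ℝ) *
      sortedEigenvalue _ (transitionMatrix_isHermitian f dS dX m) 1 := by
  have htr := trace_le_of_eigenvalues_le_one (transitionMatrix_isHermitian f dS dX m) hcard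
    (eigenvalues_le_one_of_stochastic _
      (fun i j => by simp only [transitionMatrix, of_apply]; positivity)
      (h.sum_transitionMatrix hm))
  rw [h.trace_transitionMatrix hm] at htr
  set μ := sortedEigenvalue _ (transitionMatrix_isHermitian f dS dX m) 1
  have hS : (0 : ℝ) < dS := by exact_mod_cast h.dS_pos
  have hn : (1 : ℝ) < Fintype.card X := by exact_mod_cast hcard
  have hd : 2 * (dS : ℝ) ≤ Fintype.card X := by exact_mod_cast hdS
  rw [div_le_iff₀ hS] at htr
  set n : ℝ := (Fintype.card X : ℝ)
  -- Positivity allows `|X| - 1` to be replaced by `|X|` in the trace bound.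
  have hμ : 0 < μ := by
    by_contra! hle
    nlinarith [mul_nonneg (mul_nonneg (sub_nonneg.mpr hn.le) (neg_nonneg.mpr hle)) hS.le]
  have hp : 0 < μ * dS := mul_pos hμ hS
  nlinarith

open Classical in
theorem sortedEigenvalue_one_le_lambda2 (f : S × X → N) (dS dX : ℕ) (m : N)
    (hcard : 1 < Fintype.card X) :
    sortedEigenvalue _ (transitionMatrix_isHermitian f dS dX m) 1 ≤
      lambda2 f dS dX m := by
  rw [lambda2, secondEigenvalueModulus, if_pos (show 2 ≤ Fintype.card X from hcard)]
  exact (le_abs_self _).trans (le_max_left _ _)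

open Classical in
/-- `√(d_X / 2) ≤ λ₂(G_{f,m}) ≤ √(d_S d_X λ₂(f,m))`, in squared form. -/
theorem IsBiregularIrreducible.graphLambda2_bounds (h : IsBiregularIrreducible f M dS dX)
    {m : N} (hm : m ∈ M) (hcard : 1 < Fintype.card X) (hdS : 2 * dS ≤ Fintype.card X) :
    0 < lambda2 f dS dX m ∧ 0 < graphLambda2 (bipartiteGraph f m) ∧
      (dX : ℝ) ≤ 2 * graphLambda2 (bipartiteGraph f m) ^ 2 ∧
      graphLambda2 (bipartiteGraph f m) ^ 2 ≤ dS * dX * lambda2 f dS dX m := by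
  have hS : (0 : ℝ) < dS := by exact_mod_cast h.dS_pos
  have hX : (0 : ℝ) < dX := by exact_mod_cast h.dX_pos
  have hc : 0 < (dS : ℝ) * dX := by positivity
  have hW := transpose_biadjacency_mul_self f m h.dS_pos h.dX_pos
  have hP := transitionMatrix_isHermitian f dS dX m
  have hone := h.one_le_mul_sortedEigenvalue hm hcard hdS
  have hle := sortedEigenvalue_one_le_lambda2 f dS dX m hcard
  have hG : graphLambda2 (bipartiteGraph f m) = sortedEigenvalue _
      (adjMatrix_bipartiteGraph f m ▸ adjMatrix_isHermitian (bipartiteGraph f m)) 1 := by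
    rw [graphLambda2]
    congr 1
    exact adjMatrix_bipartiteGraph f m
  set μ := sortedEigenvalue _ (transitionMatrix_isHermitian f dS dX m) 1 with hμdef
  have hμ : 0 < μ := by
    by_contra! hneg
    nlinarith
  have hA : (fromBlocks 0 (biadjacency f m) (biadjacency f m)ᵀ 0).IsHermitian :=
    adjMatrix_bipartiteGraph f m ▸ adjMatrix_isHermitian (bipartiteGraph f m)
  have hlow := sqrt_le_sortedEigenvalue_fromBlocks hc hP hW hA (by convert hμ)
  have hgpos : 0 < graphLambda2 (bipartiteGraph f m) := by
    rw [hG]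
    refine lt_of_lt_of_le (Real.sqrt_pos.mpr (mul_pos hc ?_)) hlow
    convert hμ
  have hup := sq_sortedEigenvalue_fromBlocks_le hc hP hW hA (by rw [hG] at hgpos; exact hgpos)
  rw [← hG] at hlow hup
  rw [Real.sqrt_le_left hgpos.le] at hlow
  refine ⟨hμ.trans_le hle, hgpos, ?_, hup.trans (mul_le_mul_of_nonneg_left hle hc.le)⟩
  have : (dX : ℝ) * 1 ≤ dX * (2 * dS * μ) := mul_le_mul_of_nonneg_left hone hX.le
  have h2 : (dS : ℝ) * dX * μ ≤ graphLambda2 (bipartiteGraph f m) ^ 2 := hlow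
  nlinarith

end Incidence

theorem logb_sqrt (x : ℝ) (hx : 0 ≤ x) : Real.logb 2 √x = Real.logb 2 x / 2 := by
  rw [Real.logb, Real.logb, Real.log_sqrt hx]
  ring

/-! ### Logarithmic bounds and the limit. -/

section Bounds

variable {S X N : Type*} [Fintype S] [Fintype X] {f : S × X → N} {M : Finset N} {dS dX : ℕ}

theorem IsBiregularIrreducible.maxLogGraphLambda2_bounds (h : IsBiregularIrreducible f M dS dX)
    (hM : 1 < M.card) (hcard : 1 < Fintype.card X) :
    Real.logb 2 √dX - 1 / 2 ≤ maxLogGraphLambda2 f M ∧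
      maxLogGraphLambda2 f M ≤ Real.logb 2 √dX + (Real.logb 2 (Fintype.card X) -
        Real.logb 2 M.card - minNegLogLambda2 f M dS dX) / 2 := by
  have : Nonempty X := Fintype.card_pos_iff.mp (by omega)
  have hMne : M.Nonempty := Finset.card_pos.mp (by omega)
  have : Nonempty S := h.nonempty_left hMne
  have : Nonempty M := hMne.to_subtype
  have hmul := h.card_mul_le
  have hdS : 2 * dS ≤ Fintype.card X := (Nat.mul_le_mul_right _ hM).trans hmul
  have hS : (0 : ℝ) < dS := by exact_mod_cast h.dS_pos
  have hX : (0 : ℝ) < dX := by exact_mod_cast h.dX_pos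
  have hMpos : (0 : ℝ) < M.card := by exact_mod_cast (show 0 < M.card by omega)
  have h2 : (1 : ℝ) < 2 := one_lt_two
  have hlog : Real.logb 2 M.card + Real.logb 2 dS ≤ Real.logb 2 (Fintype.card X) := by
    rw [← Real.logb_mul hMpos.ne' hS.ne']
    exact Real.logb_le_logb_of_le h2 (by positivity) (by exact_mod_cast hmul)
  rw [logb_sqrt _ hX.le]
  constructor
  · obtain ⟨m, hm⟩ := hMne
    obtain ⟨-, hg, hlow, -⟩ := h.graphLambda2_bounds hm hcard hdS
    refine le_trans ?_ (le_ciSup (f := fun m : M => Real.logb 2 (graphLambda2 (bipartiteGraph f m)))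
      (Set.finite_range _).bddAbove ⟨m, hm⟩)
    have h3 := Real.logb_le_logb_of_le h2 hX hlow
    rw [Real.logb_mul two_ne_zero (by positivity), Real.logb_pow, Real.logb_self_eq_one h2] at h3
    push_cast at h3
    linarith
  · refine ciSup_le fun ⟨m, hm⟩ => ?_
    obtain ⟨hl, hg, -, hup⟩ := h.graphLambda2_bounds hm hcard hdS
    have h3 := Real.logb_le_logb_of_le h2 (by positivity) hup
    rw [Real.logb_mul (by positivity) hl.ne', Real.logb_mul hS.ne' hX.ne', Real.logb_pow] at h3
    push_cast at h3
    have h4 : minNegLogLambda2 f M dS dX ≤ -Real.logb 2 (lambda2 f dS dX m) :=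
      ciInf_le (f := fun m : M => -Real.logb 2 (lambda2 f dS dX m))
        (Set.finite_range _).bddBelow ⟨m, hm⟩
    show Real.logb 2 (graphLambda2 (bipartiteGraph f m)) ≤ _
    linarith

end Bounds

theorem IsOptimalSequence.tendsto_sub {S X N : ℕ → Type*} [∀ i, Fintype (S i)]
    [∀ i, Fintype (X i)] {f : ∀ i, S i × X i → N i} {M : ∀ i, Finset (N i)} {dS dX : ℕ → ℕ}
    (hf : ∀ i, IsBiregularIrreducible (f i) (M i) (dS i) (dX i))
    {t : ℝ} (ht1 : t < 1) (hopt : IsOptimalSequence f M dS dX t) :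
    Tendsto (fun i => maxLogGraphLambda2 (f i) (M i) / Real.logb 2 (Fintype.card (X i)) -
      Real.logb 2 √(dX i) / Real.logb 2 (Fintype.card (X i))) atTop (𝓝 0) := by
  have hX : ∀ᶠ i in atTop, 1 < Fintype.card (X i) := hopt.card_tendsto.eventually_gt_atTop 1
  have hlogX : Tendsto (fun i => Real.logb 2 (Fintype.card (X i) : ℝ)) atTop atTop :=
    (Real.tendsto_logb_atTop one_lt_two).comp
      (tendsto_natCast_atTop_atTop.comp hopt.card_tendsto)
  have hM : ∀ᶠ i in atTop, 1 < (M i).card := by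
    filter_upwards [hopt.rate.eventually_const_lt (sub_pos.mpr ht1), hlogX.eventually_gt_atTop 0]
      with i hi hpos
    have h1 : 0 < Real.logb 2 ((M i).card : ℝ) := (div_pos_iff_of_pos_right hpos).mp hi
    by_contra! hle
    -- Both `|M| = 0` and `|M| = 1` give logarithm 0, as `Real.logb 2 0 = 0`.
    interval_cases hc : (M i).card <;> simp at h1
  have hbounds := (hlogX.eventually_gt_atTop 0).and ((hM.and hX).mono fun i hi =>
      (hf i).maxLogGraphLambda2_bounds hi.1 hi.2)
  rw [tendsto_order]
  refine ⟨fun a ha => ?_, fun a ha => ?_⟩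
  · filter_upwards [hbounds, hlogX.eventually_gt_atTop (1 / -a)] with i ⟨hpos, hlow, _⟩ hi
    rw [← sub_div, lt_div_iff₀ hpos]
    rw [div_lt_iff₀ (neg_pos.mpr ha)] at hi
    linarith
  -- A tolerance `a/2` in each of the two optimality conditions costs `a` in total, halved by the
  -- square root to `a/2 < a`.
  · have hev : ∀ᶠ i in atTop, ((t - a / 2 : ℝ) : EReal) <
        ((minNegLogLambda2 (f i) (M i) (dS i) (dX i) /
          Real.logb 2 (Fintype.card (X i) : ℝ) : ℝ) : EReal) := by
      refine eventually_lt_of_lt_liminf (lt_of_lt_of_le ?_ hopt.eigenvalue)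
      exact EReal.coe_lt_coe_iff.mpr (by linarith)
    filter_upwards [hbounds, hev, hopt.rate.eventually_const_lt
      (show 1 - t - a / 2 < 1 - t by linarith)] with i ⟨hpos, _, hup⟩ h1 h2
    rw [EReal.coe_lt_coe_iff, lt_div_iff₀ hpos] at h1
    rw [lt_div_iff₀ hpos] at h2
    rw [← sub_div, div_lt_iff₀ hpos]
    nlinarith

end BRI

theorem mainTheorem11 {S X N : ℕ → Type*} [∀ i, Fintype (S i)] [∀ i, Fintype (X i)]
    [∀ i, Fintype (N i)] (f : ∀ i, S i × X i → N i) (M : ∀ i, Finset (N i)) (dS dX : ℕ → ℕ)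
    (hf : ∀ i, BRI.IsBiregularIrreducible (f i) (M i) (dS i) (dX i))
    (t : ℝ) (ht0 : 0 ≤ t) (ht1 : t < 1) (hopt : BRI.IsOptimalSequence f M dS dX t) :
    limsup (fun i => ((BRI.maxLogGraphLambda2 (f i) (M i) /
        Real.logb 2 (Fintype.card (X i) : ℝ) : ℝ) : EReal)) atTop
      ≤ limsup (fun i => ((Real.logb 2 (Real.sqrt (dX i : ℝ)) /
        Real.logb 2 (Fintype.card (X i) : ℝ) : ℝ) : EReal)) atTop
    ∧ ((∃ a : EReal, Tendsto (fun i => ((Real.logb 2 (dS i : ℝ) /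
          Real.logb 2 (Fintype.card (X i) : ℝ) : ℝ) : EReal)) atTop (𝓝 a)) →
       (∃ b : EReal, Tendsto (fun i => ((Real.logb 2 (dX i : ℝ) /
          Real.logb 2 (Fintype.card (X i) : ℝ) : ℝ) : EReal)) atTop (𝓝 b)) →
       ∃ L : EReal,
        Tendsto (fun i => ((BRI.maxLogGraphLambda2 (f i) (M i) /
          Real.logb 2 (Fintype.card (X i) : ℝ) : ℝ) : EReal)) atTop (𝓝 L) ∧
        Tendsto (fun i => ((Real.logb 2 (Real.sqrt (dX i : ℝ)) /
          Real.logb 2 (Fintype.card (X i) : ℝ) : ℝ) : EReal)) atTop (𝓝 L)) := by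
  have hdiff := EReal.tendsto_coe.mpr (hopt.tendsto_sub hf ht1)
  have hsum : (fun i => ((BRI.maxLogGraphLambda2 (f i) (M i) /
      Real.logb 2 (Fintype.card (X i) : ℝ) : ℝ) : EReal)) =
      (fun i => ((Real.logb 2 (Real.sqrt (dX i : ℝ)) /
        Real.logb 2 (Fintype.card (X i) : ℝ) : ℝ) : EReal)) +
      fun i => ((BRI.maxLogGraphLambda2 (f i) (M i) / Real.logb 2 (Fintype.card (X i) : ℝ) -
        Real.logb 2 (Real.sqrt (dX i : ℝ)) / Real.logb 2 (Fintype.card (X i) : ℝ) : ℝ) : EReal) := by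
    funext i
    rw [Pi.add_apply, ← EReal.coe_add, add_sub_cancel]
  rw [hsum]
  constructor
  · have hlim := hdiff.limsup_eq
    -- The null sequence has finite limsup, so no `∞ - ∞` arises.
    refine (EReal.limsup_add_le (.inr ?_) (.inr ?_)).trans ?_ <;> rw [hlim]
    · exact EReal.coe_ne_top 0
    · exact EReal.coe_ne_bot 0
    · rw [EReal.coe_zero, add_zero]
  · rintro - ⟨b, hb⟩
    have hhalf : Tendsto (fun i => ((Real.logb 2 (Real.sqrt (dX i : ℝ)) /
        Real.logb 2 (Fintype.card (X i) : ℝ) : ℝ) : EReal)) atTop (𝓝 (((1 / 2 : ℝ) : EReal) * b)) := by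
      refine (EReal.Tendsto.const_mul (a := ((1 / 2 : ℝ) : EReal)) hb ?_ ?_).congr fun i => ?_
      · exact .inl (EReal.coe_ne_bot _)
      · exact .inl (EReal.coe_ne_top _)
      · rw [BRI.logb_sqrt _ (Nat.cast_nonneg _), ← EReal.coe_mul]
        congr 1
        ring
    refine ⟨_, ?_, hhalf⟩
    -- Addition is continuous at `(b/2, 0)` even for infinite `b`, because 0 is finite.
    have hcont := EReal.continuousAt_add (p := (((1 / 2 : ℝ) : EReal) * b, ((0 : ℝ) : EReal)))
      (.inr (EReal.coe_ne_bot 0)) (.inr (EReal.coe_ne_top 0))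
    have := hcont.tendsto.comp (hhalf.prodMk_nhds hdiff)
    rwa [EReal.coe_zero, add_zero] at this
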